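/- Let $a<b$ be real numbers and let $d\ge 1$. A function $u:{]a,b[}\to\mathbb{R}^m$ belongs to $BV(]a,b[;\mathbb{R}^m)$ if $u\in L^1(]a,b[;\mathbb{R}^m)$ and $$TV(u):=\sup\Big\{\int_a^b u\cdot\varphi'\,dx:\ \varphi\in C^1_c(]a,b[;\mathbb{R}^m),\ |\varphi|\le 1\Big\}<+\infty .$$ For such $u$ let $Du=(Du^1,\dots,Du^m)$ be its distributional derivative (a finite Radon measure on $]a,b[$), and set $$u(x_\pm):=\lim_{\varepsilon\to0^+}\frac1\varepsilon\int_0^{\varepsilon}u(x\pm t)\,dt,\qquad J_u:=\{x\in{]a,b[}:\ u(x_-)\neq u(x_+)\}.$$ Write $Du=\nabla u\,dx+D^su$ for the Lebesgue decomposition with respect to Lebesgue measure, $D^cu:=D^su-\big(u(x_+)-u(x_-)\big)\mathcal{H}^0\lfloor J_u$ for the Cantor part, where $\mathcal{H}^0$ is the counting measure, and $\widetilde Du:=\nabla u\,dx+D^cu$ for the diffuse part. A $BV$ function is called a good representative if its pointwise variation $\sup\sum_i|u(t_{i+1})-u(t_i)|$ over all finite increasing families $t_1<\dots<t_n$ in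 $]a,b[$ equals $TV(u)$. Let $f:\mathbb{R}\times\mathbb{R}^d\to\mathbb{R}$, $f=f(y,w)$, and $K:{]a,b[}\to\mathbb{R}$ satisfy: 1. $K\in BV(]a,b[)$, and $K$ is a good representative; 2. $f\in C^1(\mathbb{R}\times\mathbb{R}^d)$; 3. for every $w\in\mathbb{R}^d$ the function $x\mapsto f_w(K(x),w)$ belongs to $BV(]a,b[;\mathbb{R}^d)$, where $f_w$ denotes the gradient of $f$ with respect to $w$; 4. for every compact set $D\subset\mathbb{R}\times\mathbb{R}^d$ there is a constant $L_D$ such that $|f_y(y,w)-f_y(y,w')|\le L_D|w-w'|$ for all $(y,w),(y,w')\in D$, and $|f_w(y,w)-f_w(y',w)|\le L_D|y-y'|$ for all $(y,w),(y',w)\in D$. Then for every good representative $u\in BV(]a,b[;\mathbb{R}^d)$ the function $v(x):=f(K(x),u(x))$, $x\in{]a,b[}$, belongs to $BV(]a,b[)$. Moreover $f_y(K,u)$ is integrable with respect to $|\widetilde DK|$, each component of $f_w(K,u)$ is integrable with respect to the total variation of the corresponding component of $\widetilde Du$, the family $f(K(x_+),u(x_+))-f(K(x_-),u(x_-))$,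 $x\in J_u\cup J_K$, is summable, and for every $\phi\in C^1_c(]a,b[)$ $$\begin{aligned}\int_{]a,b[}\phi'(x)\,v(x)\,dx={}&-\int_{]a,b[}\phi(x)\,f_y(K(x),u(x))\,d\widetilde DK(x)-\int_{]a,b[}\phi(x)\,f_w(K(x),u(x))\cdot d\widetilde Du(x)\\&-\sum_{x\in J_u\cup J_K}\phi(x)\,\big[f(K(x_+),u(x_+))-f(K(x_-),u(x_-))\big].\end{aligned}$$ -/

import Mathlib

open MeasureTheory Set Filter Topology

noncomputable section

namespace BVChain

/-- Test functions of class `C¹` with compact support contained in the open interval `]a,b[`. -/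
structure IsTestFunction {E : Type*} [NormedAddCommGroup E] [NormedSpace ℝ E]
    (a b : ℝ) (φ : ℝ → E) : Prop where
  contDiff : ContDiff ℝ 1 φ
  hasCompactSupport : HasCompactSupport φ
  tsupport_subset : tsupport φ ⊆ Ioo a b

/-- The variation `TV(u)` of `u` on `]a,b[`: the supremum of `∫ u · φ' dx` over the test fields `φ`
with `|φ| ≤ 1` everywhere. Only the values of `u` in `]a,b[` (up to null sets) matter. -/
def totalVar {E : Type*} [NormedAddCommGroup E] [InnerProductSpace ℝ E]
    (a b : ℝ) (u : ℝ → E) : ENNReal :=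
  ⨆ (φ : ℝ → E) (_ : IsTestFunction a b φ) (_ : ∀ x, ‖φ x‖ ≤ 1),
    ENNReal.ofReal (∫ x in Ioo a b, inner ℝ (u x) (deriv φ x))

/-- `u ∈ BV(]a,b[; E)`: `u` is integrable on `]a,b[` and has finite variation. -/
def IsBV {E : Type*} [NormedAddCommGroup E] [InnerProductSpace ℝ E]
    (a b : ℝ) (u : ℝ → E) : Prop :=
  IntegrableOn u (Ioo a b) ∧ totalVar a b u < ⊤

/-- `u` is a good representative of its class: its pointwise variation on `]a,b[`
(`eVariationOn`, the supremum of `∑ |u(t_{i+1}) - u(t_i)|` over finite increasing families of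
points of `]a,b[`) equals the variation `TV(u)` of the class. -/
def IsGoodRepresentative {E : Type*} [NormedAddCommGroup E] [InnerProductSpace ℝ E]
    (a b : ℝ) (u : ℝ → E) : Prop :=
  eVariationOn u (Ioo a b) = totalVar a b u

/-- The left limit `u(x₋)`, the limit as `ε → 0+` of the averages of `u` over `]x-ε,x[`. -/
def leftTrace {E : Type*} [NormedAddCommGroup E] [NormedSpace ℝ E] (u : ℝ → E) (x : ℝ) : E :=
  limUnder (𝓝[>] (0 : ℝ)) (fun ε : ℝ => ε⁻¹ • ∫ y in (x - ε)..x, u y)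

/-- The right limit `u(x₊)`, the limit as `ε → 0+` of the averages of `u` over `]x,x+ε[`. -/
def rightTrace {E : Type*} [NormedAddCommGroup E] [NormedSpace ℝ E] (u : ℝ → E) (x : ℝ) : E :=
  limUnder (𝓝[>] (0 : ℝ)) (fun ε : ℝ => ε⁻¹ • ∫ y in x..(x + ε), u y)

/-- The jump set `J_u = {x ∈ ]a,b[ : u(x₋) ≠ u(x₊)}`. -/
def jumpSet {E : Type*} [NormedAddCommGroup E] [NormedSpace ℝ E]
    (a b : ℝ) (u : ℝ → E) : Set ℝ :=
  {x | x ∈ Ioo a b ∧ leftTrace u x ≠ rightTrace u x}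

/-- The finite signed measure `μ` on `]a,b[` (a signed measure on `ℝ` concentrated on `]a,b[`) is
the distributional derivative of `w` in `]a,b[`. -/
def IsDistribDeriv (a b : ℝ) (w : ℝ → ℝ) (μ : SignedMeasure ℝ) : Prop :=
  μ.restrict (Ioo a b) = μ ∧
    ∀ φ : ℝ → ℝ, IsTestFunction a b φ →
      ∫ x in Ioo a b, w x * deriv φ x = -∫ᵛ x, φ x ∂<•μ

open Classical in
/-- The distributional derivative `Dw` of a scalar function `w` on `]a,b[` as a signed measure.
It exists and is unique when `w` belongs to `BV(]a,b[)` (the value `0` used when there is no such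
measure is irrelevant). -/
def distribDeriv (a b : ℝ) (w : ℝ → ℝ) : SignedMeasure ℝ :=
  if h : ∃ μ : SignedMeasure ℝ, IsDistribDeriv a b w μ then h.choose else 0

/-- The absolutely continuous part `∇w dx` of `Dw`, where `∇w` is the density of the absolutely
continuous part of `Dw` with respect to the Lebesgue measure. -/
def absContPart (a b : ℝ) (w : ℝ → ℝ) : SignedMeasure ℝ :=
  (volume : Measure ℝ).withDensityᵥ ((distribDeriv a b w).rnDeriv volume)

/-- The atomic part `D^j w = (w(x₊) - w(x₋)) 𝓗⁰⌊J_w` of `Dw`. -/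
def atomicPart (a b : ℝ) (w : ℝ → ℝ) : SignedMeasure ℝ :=
  ((Measure.count : Measure ℝ).restrict (jumpSet a b w)).withDensityᵥ
    (fun x => rightTrace w x - leftTrace w x)

/-- The Cantor part `D^c w = D^s w - D^j w`, where `D^s w` is the part of `Dw` that is singular with
respect to the Lebesgue measure. -/
def cantorPart (a b : ℝ) (w : ℝ → ℝ) : SignedMeasure ℝ :=
  (distribDeriv a b w).singularPart volume - atomicPart a b w

/-- The diffuse part `∇w dx + D^c w` of `Dw`. For a vector valued function `u = (u¹, …, u^d)` the
diffuse part is the vector of the diffuse parts of the components. -/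
def diffusePart (a b : ℝ) (w : ℝ → ℝ) : SignedMeasure ℝ :=
  absContPart a b w + cantorPart a b w

/-- The partial derivative `f_y(y, w)` of `f = f(y, w)` in the scalar variable `y`. -/
def partialY {d : ℕ} (f : ℝ → EuclideanSpace ℝ (Fin d) → ℝ) (y : ℝ)
    (w : EuclideanSpace ℝ (Fin d)) : ℝ :=
  deriv (fun t => f t w) y

/-- The partial gradient `f_w(y, w) ∈ ℝ^d` of `f = f(y, w)` in the vector variable `w`. -/
def partialW {d : ℕ} (f : ℝ → EuclideanSpace ℝ (Fin d) → ℝ) (y : ℝ)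
    (w : EuclideanSpace ℝ (Fin d)) : EuclideanSpace ℝ (Fin d) :=
  gradient (f y) w

end BVChain

end

/-!
The chain rule follows from differentiating measures along shrinking intervals. Equality of the
pointwise variation with `TV` makes `K` and `u` functions of finite pointwise variation on `]a,b[`,
and so is `v = f(K, u)`, because a `C¹` function is Lipschitz on a ball containing the bounded range
of `(K, u)`. For a scalar function `w` of finite pointwise variation, `Dw` is the Stieltjes measure
of `w` (`exists_isDistribDeriv`, by integration by parts, and `IsDistribDeriv.unique`), hence
`Dw [s, t] = w(t₊) - w(s₋)` (`distribDeriv_Icc`); its diffuse part is its restriction to the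
complement of any countable set containing `J_w` (`diffusePart_eq_restrict`).

Let `σ` be the sum of the total variations of `DK`, `Duⁱ` and `Dv`, and write these measures as
`gK σ`, `gⁱ σ` and `gv σ`. By the Besicovitch differentiation theorem, at `σ`-almost every `x` the
densities are the limits of the quotients `DK(I) / σ(I)`, etc., over `I = [x - r, x + r]`
(`ae_tendsto_inv_mul_apply_Icc`). Outside the countable jump set `J = J_u ∪ J_K` the functions `K`
and `u` are continuous at `σ`-almost every point, since the remaining discontinuities are countably
many points without mass. At such an `x`, with `p` and `q` the traces of `(K, u)` at `(x + r)₊` and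
`(x - r)₋`, we have `Dv(I) = f(p) - f(q)` and `p, q → (K(x), u(x))`, so strict differentiability of
`f` gives `gv = f_y(K, u) gK + ∑ᵢ f_w(K, u)ⁱ gⁱ` (`density_comp_eq`). On `J` the measure `Dv` is a
sum of point masses `Dv {x} = f(K(x₊), u(x₊)) - f(K(x₋), u(x₋))`. Adding the two contributions to
`∫ φ' v = -∫ φ dDv` gives the formula.
-/

namespace BVChain

variable {a b : ℝ} {d : ℕ}

/-! ### Signed measures with a density -/

instance isFiniteMeasure_variation_signedMeasure {X : Type*} [MeasurableSpace X]
    (μ : SignedMeasure X) : IsFiniteMeasure μ.variation := by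
  rw [← SignedMeasure.totalVariation_eq_variation]
  infer_instance

theorem integrable_variation_withDensityᵥ {X : Type*} [MeasurableSpace X] {σ : Measure X}
    {g φ : X → ℝ} (hg : Integrable g σ) (hφ : AEStronglyMeasurable φ σ)
    (hφg : Integrable (fun x => φ x * g x) σ) :
    (σ.withDensityᵥ g).Integrable φ := by
  rw [VectorMeasure.Integrable, Measure.variation_withDensityᵥ hg]
  rw [integrable_withDensity_iff_integrable_smul₀' hg.1.enorm (by simp)]
  refine hφg.mono (hg.1.enorm.ennreal_toReal.aestronglyMeasurable.smul hφ) ?_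
  filter_upwards with x
  simp [mul_comm]

/-- Integrating against a signed measure with density `g` is integrating `φ * g`. The integrability
of `φ * g` is split along the sign of `g`, since the positive and negative parts of the measure are
`σ` with densities `g⁺` and `g⁻`. -/
theorem integral_withDensityᵥ {X : Type*} [MeasurableSpace X] {σ : Measure X}
    {g φ : X → ℝ} (hg : Integrable g σ) (hφ : AEStronglyMeasurable φ σ)
    (hφg : Integrable (fun x => φ x * g x) σ) :
    ∫ᵛ x, φ x ∂<•(σ.withDensityᵥ g) = ∫ x, φ x * g x ∂σ := by
  have key : ∀ h : X → ℝ, AEMeasurable h σ → (∀ x, ‖h x‖ ≤ ‖g x‖) →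
      Integrable φ (σ.withDensity fun x => ENNReal.ofReal (h x)) ∧
      Integrable (fun x => max (h x) 0 * φ x) σ ∧
      ∫ x, φ x ∂(σ.withDensity fun x => ENNReal.ofReal (h x)) = ∫ x, max (h x) 0 * φ x ∂σ := by
    intro h hm hh
    have hint : Integrable (fun x => max (h x) 0 * φ x) σ := by
      refine hφg.mono ((hm.max aemeasurable_const).aestronglyMeasurable.mul hφ) ?_
      filter_upwards with x
      rw [norm_mul, norm_mul, mul_comm]
      gcongr
      refine le_trans ?_ (hh x)
      rw [Real.norm_eq_abs, Real.norm_eq_abs, abs_of_nonneg (le_max_right _ _)]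
      exact max_le (le_abs_self _) (abs_nonneg _)
    refine ⟨?_, hint, ?_⟩
    · rw [integrable_withDensity_iff_integrable_smul₀' hm.ennreal_ofReal (by simp)]
      simpa [ENNReal.toReal_ofReal'] using hint
    · rw [integral_withDensity_eq_integral_toReal_smul₀ hm.ennreal_ofReal (by simp)]
      simp [ENNReal.toReal_ofReal']
  obtain ⟨hp, hp', hp''⟩ := key g hg.1.aemeasurable fun x => le_rfl
  obtain ⟨hn, hn', hn''⟩ := key (fun x => -g x) hg.1.aemeasurable.neg fun x => by simp
  have := isFiniteMeasure_withDensity_ofReal hg.2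
  have := isFiniteMeasure_withDensity_ofReal hg.neg.2
  rw [withDensityᵥ_eq_withDensity_pos_part_sub_withDensity_neg_part hg,
    VectorMeasure.integral_sub_vectorMeasure, VectorMeasure.integral_toSignedMeasure,
    VectorMeasure.integral_toSignedMeasure, hp'', hn'', ← integral_sub hp' hn']
  · refine integral_congr_ae (Eventually.of_forall fun x => ?_)
    rcases le_total (g x) 0 with h | h <;> simp [h, mul_comm]
  · simpa [VectorMeasure.Integrable] using hp
  · simpa [VectorMeasure.Integrable] using hn

/-- Radon–Nikodym for a signed measure dominated by `σ`; the measurability of the density is part of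
`Integrable`. -/
theorem exists_eq_withDensityᵥ {X : Type*} [MeasurableSpace X] (μ : SignedMeasure X)
    {σ : Measure X} [IsFiniteMeasure σ] (h : μ.variation ≤ σ) :
    ∃ g : X → ℝ, Integrable g σ ∧ μ = σ.withDensityᵥ g := by
  refine ⟨μ.rnDeriv σ, SignedMeasure.integrable_rnDeriv μ σ,
    (SignedMeasure.withDensityᵥ_rnDeriv_eq μ σ ?_).symm⟩
  refine VectorMeasure.AbsolutelyContinuous.mk fun s hs h0 => ?_
  rw [Measure.toENNRealVectorMeasure_apply_measurable hs] at h0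
  have := VectorMeasure.enorm_measure_le_variation μ s
  have h2 := h s
  simp only [h0] at h2
  simpa using this.trans h2

/-! ### Functions of bounded variation on an interval -/

/-- A function whose increments are controlled by those of two functions of bounded variation has
bounded variation. -/
theorem boundedVariationOn_of_edist_le {α E F G : Type*} [LinearOrder α] [PseudoEMetricSpace E]
    [PseudoEMetricSpace F] [PseudoEMetricSpace G] {f : α → E} {g : α → F} {v : α → G} {s : Set α}
    {C : NNReal} (hf : BoundedVariationOn f s) (hg : BoundedVariationOn g s)
    (h : ∀ x ∈ s, ∀ y ∈ s, edist (v x) (v y) ≤ C * (edist (f x) (f y) + edist (g x) (g y))) :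
    BoundedVariationOn v s := by
  refine ne_top_of_le_ne_top (b := C * (eVariationOn f s + eVariationOn g s))
    (ENNReal.mul_ne_top ENNReal.coe_ne_top (ENNReal.add_ne_top.2 ⟨hf, hg⟩)) ?_
  refine iSup_le fun p => ?_
  calc ∑ i ∈ Finset.range p.1, edist (v (p.2.1 (i + 1))) (v (p.2.1 i))
      ≤ ∑ i ∈ Finset.range p.1, C * (edist (f (p.2.1 (i + 1))) (f (p.2.1 i))
          + edist (g (p.2.1 (i + 1))) (g (p.2.1 i))) :=
        Finset.sum_le_sum fun i _ => h _ (p.2.2.2 _) _ (p.2.2.2 _)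
    _ ≤ C * (eVariationOn f s + eVariationOn g s) := by
        rw [← Finset.mul_sum, Finset.sum_add_distrib]
        gcongr
        · exact eVariationOn.sum_le p.2.2.1 p.2.2.2
        · exact eVariationOn.sum_le p.2.2.1 p.2.2.2

theorem exists_bound_of_boundedVariationOn {α E : Type*} [LinearOrder α] [SeminormedAddCommGroup E]
    {f : α → E} {s : Set α} (hf : BoundedVariationOn f s) : ∃ C, ∀ x ∈ s, ‖f x‖ ≤ C := by
  rcases s.eq_empty_or_nonempty with rfl | ⟨c, hc⟩
  · exact ⟨0, by simp⟩
  refine ⟨‖f c‖ + (eVariationOn f s).toReal, fun x hx => ?_⟩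
  have := hf.dist_le hx hc
  rw [dist_eq_norm] at this
  linarith [norm_le_norm_add_norm_sub' (f x) (f c)]

/-- A monotone function bounded on `s` agrees on `s` with a monotone function bounded on the
whole line. -/
theorem exists_monotone_bounded_extension {p : ℝ → ℝ} {s : Set ℝ} (hp : MonotoneOn p s) {C : ℝ}
    (hC : ∀ x ∈ s, |p x| ≤ C) : ∃ P : ℝ → ℝ, Monotone P ∧ BoundedVariationOn P univ ∧ EqOn P p s := by
  obtain ⟨P, hP, hPp⟩ := hp.exists_monotone_extension
    ⟨-C, by rintro _ ⟨x, hx, rfl⟩; exact (abs_le.1 (hC x hx)).1⟩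
    ⟨C, by rintro _ ⟨x, hx, rfl⟩; exact (abs_le.1 (hC x hx)).2⟩
  have hmono : Monotone fun x => max (min (P x) C) (-C) :=
    fun x y hxy => max_le_max (min_le_min (hP hxy) le_rfl) le_rfl
  refine ⟨_, hmono, (hmono.monotoneOn _).boundedVariationOn (C := |C|) fun x _ => ?_,
    fun x hx => ?_⟩
  · refine abs_le.2 ⟨?_, ?_⟩
    · exact (neg_le_neg (le_abs_self C)).trans (le_max_right _ _)
    · exact max_le ((min_le_right _ _).trans (le_abs_self _)) (neg_le_abs C)
  · have := abs_le.1 (hC x hx)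
    simp only [← hPp hx]
    rw [min_eq_left this.2, max_eq_left this.1]

/-- A scalar function of bounded variation on `s` agrees on `s` with a measurable function of bounded
variation on the line with countably many discontinuities: both terms of its decomposition as a
difference of monotone functions extend, being bounded on `s`. -/
theorem exists_boundedVariationOn_univ_extension {w : ℝ → ℝ} {s : Set ℝ}
    (hw : BoundedVariationOn w s) :
    ∃ W : ℝ → ℝ, BoundedVariationOn W univ ∧ Measurable W ∧ {x | ¬ContinuousAt W x}.Countable ∧
      EqOn W w s := by
  obtain ⟨p, q, hp, hq, rfl, hpq⟩ := hw.locallyBoundedVariationOn.exists_monotoneOn_sub_monotoneOn'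
  have hvar : ∀ x ∈ s, ∀ y ∈ s, |p x - p y| ≤ (eVariationOn (p - q) s).toReal ∧
      |q x - q y| ≤ (eVariationOn (p - q) s).toReal := by
    intro x hx y hy
    have h1 := hpq x hx y hy
    have h2 := abs_le.1 (variationOnFromTo.abs_le_eVariationOn hw (a := x) (b := y))
    rcases le_total x y with h | h
    · have h3 := hp hx hy h
      have h4 := hq hx hy h
      constructor <;> refine abs_le.2 ⟨?_, ?_⟩ <;> linarith
    · have h3 := hp hy hx h
      have h4 := hq hy hx h
      constructor <;> refine abs_le.2 ⟨?_, ?_⟩ <;> linarith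
  have hbdd : ∀ f : ℝ → ℝ, (∀ x ∈ s, ∀ y ∈ s, |f x - f y| ≤ (eVariationOn (p - q) s).toReal) →
      ∃ C, ∀ x ∈ s, |f x| ≤ C := by
    intro f hf
    rcases s.eq_empty_or_nonempty with rfl | ⟨c, hc⟩
    · exact ⟨0, by simp⟩
    refine ⟨|f c| + (eVariationOn (p - q) s).toReal, fun x hx => ?_⟩
    have := hf x hx c hc
    linarith [abs_sub_abs_le_abs_sub (f x) (f c)]
  obtain ⟨C, hC⟩ := hbdd p fun x hx y hy => (hvar x hx y hy).1
  obtain ⟨D, hD⟩ := hbdd q fun x hx y hy => (hvar x hx y hy).2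
  obtain ⟨P, hP, hPv, hPp⟩ := exists_monotone_bounded_extension hp hC
  obtain ⟨Q, hQ, hQv, hQq⟩ := exists_monotone_bounded_extension hq hD
  refine ⟨P - Q, ?_, hP.measurable.sub hQ.measurable, ?_, fun x hx => ?_⟩
  · refine boundedVariationOn_of_edist_le (C := 1) hPv hQv fun x _ y _ => ?_
    simp only [Pi.sub_apply, ENNReal.coe_one, one_mul, sub_eq_add_neg]
    exact (edist_add_add_le _ _ _ _).trans (by simp)
  · refine (hP.countable_not_continuousAt.union hQ.countable_not_continuousAt).mono fun x hx => ?_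
    by_contra hcon
    simp only [mem_union, mem_ofPred_eq, not_or, not_not] at hcon
    exact hx (hcon.1.sub hcon.2)
  · simp [hPp hx, hQq hx]

/-- Integration by parts against the Stieltjes measure of a function of bounded variation: writing
`φ x = ∫ t in Iic x, φ' t` and exchanging the integrals, the tail mass `μ [t, ∞)` appears, which is
a constant minus the left limit of `W` at `t`. -/
theorem integral_mul_deriv_eq_neg_integral_vectorMeasure {W : ℝ → ℝ}
    (hW : BoundedVariationOn W univ) (hWm : Measurable W) (hc : {x | ¬ContinuousAt W x}.Countable)
    {φ : ℝ → ℝ} (hφ : ContDiff ℝ 1 φ) (hs : HasCompactSupport φ) :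
    ∫ x, W x * deriv φ x = -∫ᵛ x, φ x ∂<•hW.vectorMeasure := by
  set μ := hW.vectorMeasure with hμ
  obtain ⟨g, hg, hμg⟩ := exists_eq_withDensityᵥ μ le_rfl
  set ρ := μ.variation
  have hφ' : Continuous (deriv φ) := hφ.continuous_deriv le_rfl
  have hφ'int : Integrable (deriv φ) := hφ'.integrable_of_hasCompactSupport hs.deriv
  obtain ⟨C, hC⟩ := hs.exists_bound_of_continuous hφ.continuous
  have hφg : Integrable (fun x => φ x * g x) ρ :=
    hg.bdd_mul hφ.continuous.aestronglyMeasurable (Eventually.of_forall hC)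
  have hprod : Integrable (Function.uncurry fun x t : ℝ => indicator (Iic x) (deriv φ) t * g x)
      (ρ.prod volume) := by
    have h0 : Integrable (fun z : ℝ × ℝ => g z.1 * deriv φ z.2) (ρ.prod volume) :=
      hg.mul_prod hφ'int
    refine (h0.indicator (s := {z : ℝ × ℝ | z.2 ≤ z.1})
      (measurableSet_le measurable_snd measurable_fst)).congr (Eventually.of_forall ?_)
    rintro ⟨x, t⟩
    by_cases h : t ≤ x <;> simp [Function.uncurry, indicator, h, mul_comm]
  have hleft : ∀ᵐ t, W.leftLim t = W t := by
    have : ∀ᵐ t, t ∉ {x | ¬ContinuousAt W x} := hc.ae_notMem _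
    filter_upwards [this] with t ht
    simp only [not_not] at ht
    exact tendsto_nhds_unique (hW.tendsto_leftLim t) (ht.tendsto.mono_left nhdsWithin_le_nhds)
  have hzero : ∫ t, deriv φ t = 0 := by
    exact integral_eq_zero_of_hasDerivAt_of_integrable
      (fun x => (hφ.differentiable one_ne_zero x).hasDerivAt) hφ'int
      (hφ.continuous.integrable_of_hasCompactSupport hs)
  have hWint : Integrable fun t => W t * deriv φ t := by
    obtain ⟨D, hD⟩ := exists_bound_of_boundedVariationOn hW
    exact hφ'int.bdd_mul hWm.aestronglyMeasurable (Eventually.of_forall fun x => hD x (mem_univ x))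
  calc ∫ x, W x * deriv φ x
      = -∫ t, deriv φ t * (limUnder atTop W - W.leftLim t) := by
        have : (fun t => deriv φ t * (limUnder atTop W - W.leftLim t)) =ᵐ[volume]
            fun t => limUnder atTop W * deriv φ t - W t * deriv φ t := by
          filter_upwards [hleft] with t ht
          rw [ht]; ring
        rw [integral_congr_ae this, integral_sub (hφ'int.const_mul _) hWint, integral_const_mul,
          hzero]
        ring
    _ = -∫ t, ∫ x, indicator (Iic x) (deriv φ) t * g x ∂ρ := by
        congr 2 with t
        rw [← hW.vectorMeasure_Ici, ← hμ, hμg, withDensityᵥ_apply hg measurableSet_Ici,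
          ← integral_const_mul, ← integral_indicator measurableSet_Ici]
        congr 1 with x
        by_cases h : t ≤ x <;> simp [indicator, h]
    _ = -∫ x, φ x * g x ∂ρ := by
        rw [← integral_integral_swap hprod]
        congr 2 with x
        rw [integral_mul_const, integral_indicator measurableSet_Iic,
          hs.integral_Iic_deriv_eq hφ]
    _ = -∫ᵛ x, φ x ∂<•μ := by
        rw [hμg, integral_withDensityᵥ hg hφ.continuous.aestronglyMeasurable hφg]

theorem rightTrace_eq {E : Type*} [NormedAddCommGroup E] [NormedSpace ℝ E] [CompleteSpace E]
    {a b : ℝ} {u : ℝ → E} (hu : IntegrableOn u (Ioo a b)) {x : ℝ} (hx : x ∈ Ioo a b) {l : E}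
    (hl : Tendsto u (𝓝[>] x) (𝓝 l)) : rightTrace u x = l := by
  have hmeas : StronglyMeasurableAtFilter u (𝓝[>] x) volume :=
    ⟨Ioo x b, Ioo_mem_nhdsGT hx.2, (hu.mono_set (Ioo_subset_Ioo_left hx.1.le)).1⟩
  have := intervalIntegral.integral_hasDerivWithinAt_of_tendsto_ae_right (a := x) (b := x)
    (s := Ici x) (t := Ioi x) (by simp) hmeas (hl.mono_left inf_le_left)
  refine Tendsto.limUnder_eq ?_
  have h2 := (hasDerivWithinAt_iff_tendsto_slope' (by simp)).1 (this.mono Ioi_subset_Ici_self)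
  have h3 : Tendsto (fun ε : ℝ => x + ε) (𝓝[>] 0) (𝓝[>] x) := by
    have : Tendsto (fun ε : ℝ => x + ε) (𝓝 0) (𝓝 x) := by
      simpa using (continuous_const_add x).tendsto 0
    refine tendsto_nhdsWithin_iff.2 ⟨this.mono_left nhdsWithin_le_nhds, ?_⟩
    filter_upwards [self_mem_nhdsWithin] with ε hε using by simpa using hε
  refine (h2.comp h3).congr fun ε => ?_
  simp [slope]

theorem leftTrace_eq {E : Type*} [NormedAddCommGroup E] [NormedSpace ℝ E] [CompleteSpace E]
    {a b : ℝ} {u : ℝ → E} (hu : IntegrableOn u (Ioo a b)) {x : ℝ} (hx : x ∈ Ioo a b) {l : E}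
    (hl : Tendsto u (𝓝[<] x) (𝓝 l)) : leftTrace u x = l := by
  have hmeas : StronglyMeasurableAtFilter u (𝓝[≤] x) volume :=
    ⟨Ioc a x, Ioc_mem_nhdsLE hx.1, (hu.mono_set fun y hy => ⟨hy.1, hy.2.trans_lt hx.2⟩).1⟩
  -- The differentiation theorem is stated for `𝓝[≤] x`; the point `x` itself is a null set.
  have hae : 𝓝[≤] x ⊓ ae volume ≤ 𝓝[<] x := by
    have h1 : ({x}ᶜ : Set ℝ) ∈ ae volume := by simp [mem_ae_iff]
    have h2 : Iio x = Iic x ∩ {x}ᶜ := by ext y; simp [lt_iff_le_and_ne]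
    rw [h2, nhdsWithin_inter']
    exact inf_le_inf_left _ (le_principal_iff.2 h1)
  have := intervalIntegral.integral_hasDerivWithinAt_of_tendsto_ae_right (a := x) (b := x)
    (s := Iic x) (t := Iic x) (by simp) hmeas (hl.mono_left hae)
  refine Tendsto.limUnder_eq ?_
  have h2 := (hasDerivWithinAt_iff_tendsto_slope' (by simp)).1 (this.mono Iio_subset_Iic_self)
  have h3 : Tendsto (fun ε : ℝ => x - ε) (𝓝[>] 0) (𝓝[<] x) := by
    have : Tendsto (fun ε : ℝ => x - ε) (𝓝 0) (𝓝 x) := by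
      simpa using! (continuous_const.sub continuous_id : Continuous fun ε : ℝ => x - ε).tendsto 0
    refine tendsto_nhdsWithin_iff.2 ⟨this.mono_left nhdsWithin_le_nhds, ?_⟩
    filter_upwards [self_mem_nhdsWithin] with ε hε using by simpa using hε
  refine (h2.comp h3).congr fun ε => ?_
  simp [slope, intervalIntegral.integral_symm x (x - ε)]

/-! ### The distributional derivative of a function of bounded variation -/

theorem tendsto_rightTrace {E : Type*} [NormedAddCommGroup E] [NormedSpace ℝ E] [CompleteSpace E]
    {u : ℝ → E} (hv : BoundedVariationOn u (Ioo a b)) (hu : IntegrableOn u (Ioo a b)) {x : ℝ}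
    (hx : x ∈ Ioo a b) : Tendsto u (𝓝[>] x) (𝓝 (rightTrace u x)) := by
  obtain ⟨l, hl⟩ := hv.exists_tendsto_right x
  rw [inter_comm, nhdsWithin_inter_of_mem' (mem_nhdsWithin_of_mem_nhds (Ioo_mem_nhds hx.1 hx.2))] at hl
  rwa [rightTrace_eq hu hx hl]

theorem tendsto_leftTrace {E : Type*} [NormedAddCommGroup E] [NormedSpace ℝ E] [CompleteSpace E]
    {u : ℝ → E} (hv : BoundedVariationOn u (Ioo a b)) (hu : IntegrableOn u (Ioo a b)) {x : ℝ}
    (hx : x ∈ Ioo a b) : Tendsto u (𝓝[<] x) (𝓝 (leftTrace u x)) := by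
  obtain ⟨l, hl⟩ := hv.exists_tendsto_left x
  rw [inter_comm, nhdsWithin_inter_of_mem' (mem_nhdsWithin_of_mem_nhds (Ioo_mem_nhds hx.1 hx.2))] at hl
  rwa [leftTrace_eq hu hx hl]

theorem integrableOn_of_boundedVariationOn {w : ℝ → ℝ} (hw : BoundedVariationOn w (Ioo a b)) :
    IntegrableOn w (Ioo a b) := by
  obtain ⟨W, hWv, hWm, -, hWw⟩ := exists_boundedVariationOn_univ_extension hw
  obtain ⟨C, hC⟩ := exists_bound_of_boundedVariationOn hWv
  refine IntegrableOn.congr_fun ?_ hWw measurableSet_Ioo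
  exact Measure.integrableOn_of_bounded (M := C) measure_Ioo_lt_top.ne hWm.aestronglyMeasurable
    (Eventually.of_forall fun x => hC x (mem_univ x))

theorem countable_not_continuousAt_of_boundedVariationOn {w : ℝ → ℝ}
    (hw : BoundedVariationOn w (Ioo a b)) : {x ∈ Ioo a b | ¬ContinuousAt w x}.Countable := by
  obtain ⟨W, -, -, hc, hWw⟩ := exists_boundedVariationOn_univ_extension hw
  refine hc.mono fun x hx => ?_
  change ¬ContinuousAt W x
  refine fun hcon => hx.2 (hcon.congr ?_)
  filter_upwards [Ioo_mem_nhds hx.1.1 hx.1.2] with y hy using hWw hy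

/-- The distributional derivative exists, and gives compact intervals the increment of the traces.
It is the Stieltjes measure of an extension of `w` to the line, restricted to `]a,b[`. -/
theorem exists_isDistribDeriv {w : ℝ → ℝ} (hw : BoundedVariationOn w (Ioo a b)) :
    ∃ μ : SignedMeasure ℝ, IsDistribDeriv a b w μ ∧ ∀ s ∈ Ioo a b, ∀ t ∈ Ioo a b, s ≤ t →
      μ (Icc s t) = rightTrace w t - leftTrace w s := by
  obtain ⟨W, hWv, hWm, hc, hWw⟩ := exists_boundedVariationOn_univ_extension hw
  have hwint := integrableOn_of_boundedVariationOn hw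
  refine ⟨hWv.vectorMeasure.restrict (Ioo a b), ⟨?_, fun φ hφ => ?_⟩, fun s hs t ht hst => ?_⟩
  · rw [VectorMeasure.restrict_restrict _ measurableSet_Ioo measurableSet_Ioo, inter_self]
  · have h1 : ∀ x ∉ Ioo a b, φ x = 0 := fun x hx =>
      image_eq_zero_of_notMem_tsupport fun h => hx (hφ.tsupport_subset h)
    have h2 : ∀ x ∉ Ioo a b, deriv φ x = 0 := fun x hx =>
      image_eq_zero_of_notMem_tsupport fun h => hx (hφ.tsupport_subset
        (tsupport_deriv_subset (𝕜 := ℝ) h))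
    rw [← VectorMeasure.integral_indicator measurableSet_Ioo, indicator_eq_self.2
      (fun x hx => by_contra fun h => hx (h1 x h)),
      ← integral_mul_deriv_eq_neg_integral_vectorMeasure hWv hWm hc hφ.contDiff
        hφ.hasCompactSupport,
      ← setIntegral_eq_integral_of_forall_compl_eq_zero (s := Ioo a b)
        (f := fun x => W x * deriv φ x) (fun x hx => by rw [h2 x hx, mul_zero])]
    exact setIntegral_congr_fun measurableSet_Ioo fun x hx => by rw [hWw hx]
  · rw [VectorMeasure.restrict_apply _ measurableSet_Ioo measurableSet_Icc,
      inter_eq_self_of_subset_left (Icc_subset_Ioo hs.1 ht.2), hWv.vectorMeasure_Icc hst]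
    congr 1
    · refine tendsto_nhds_unique (hWv.tendsto_rightLim t) ((tendsto_rightTrace hw hwint ht).congr' ?_)
      filter_upwards [mem_nhdsWithin_of_mem_nhds (Ioo_mem_nhds ht.1 ht.2)] with y hy
        using (hWw hy).symm
    · refine tendsto_nhds_unique (hWv.tendsto_leftLim s) ((tendsto_leftTrace hw hwint hs).congr' ?_)
      filter_upwards [mem_nhdsWithin_of_mem_nhds (Ioo_mem_nhds hs.1 hs.2)] with y hy
        using (hWw hy).symm

/-- Writing both measures with densities with respect to the sum of their variations, the densities
agree almost everywhere on `]a,b[` by the fundamental lemma of the calculus of variations. -/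
theorem IsDistribDeriv.unique {w : ℝ → ℝ} {μ ν : SignedMeasure ℝ} (hμ : IsDistribDeriv a b w μ)
    (hν : IsDistribDeriv a b w ν) : μ = ν := by
  obtain ⟨g, hg, hμg⟩ := exists_eq_withDensityᵥ (σ := μ.variation + ν.variation) μ
    (Measure.le_add_right le_rfl)
  obtain ⟨h, hh, hνh⟩ := exists_eq_withDensityᵥ (σ := μ.variation + ν.variation) ν
    (Measure.le_add_left le_rfl)
  set σ := μ.variation + ν.variation
  have key : ∀ᵐ x ∂σ, x ∈ Ioo a b → g x - h x = 0 := by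
    refine isOpen_Ioo.ae_eq_zero_of_integral_contDiff_smul_eq_zero
      ((hg.sub hh).locallyIntegrable.locallyIntegrableOn _) fun φ hφ hφs hφt => ?_
    have htest : IsTestFunction a b φ := ⟨hφ.of_le (by exact_mod_cast le_top), hφs, hφt⟩
    obtain ⟨C, hC⟩ := hφs.exists_bound_of_continuous hφ.continuous
    have i1 : Integrable (fun x => φ x * g x) σ :=
      hg.bdd_mul hφ.continuous.aestronglyMeasurable (Eventually.of_forall hC)
    have i2 : Integrable (fun x => φ x * h x) σ :=
      hh.bdd_mul hφ.continuous.aestronglyMeasurable (Eventually.of_forall hC)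
    have e1 := hμ.2 φ htest
    rw [hν.2 φ htest, hμg, hνh, integral_withDensityᵥ hg hφ.continuous.aestronglyMeasurable i1,
      integral_withDensityᵥ hh hφ.continuous.aestronglyMeasurable i2] at e1
    simp only [smul_eq_mul, mul_sub]
    rw [integral_sub i1 i2]
    linarith
  rw [← hμ.1, ← hν.1]
  ext s hs
  rw [VectorMeasure.restrict_apply _ measurableSet_Ioo hs,
    VectorMeasure.restrict_apply _ measurableSet_Ioo hs, hμg, hνh,
    withDensityᵥ_apply hg (hs.inter measurableSet_Ioo),
    withDensityᵥ_apply hh (hs.inter measurableSet_Ioo)]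
  refine setIntegral_congr_ae (hs.inter measurableSet_Ioo) ?_
  filter_upwards [key] with x hx hxs using sub_eq_zero.1 (hx hxs.2)

theorem isDistribDeriv_distribDeriv {w : ℝ → ℝ} (hw : BoundedVariationOn w (Ioo a b)) :
    IsDistribDeriv a b w (distribDeriv a b w) := by
  have h : ∃ μ : SignedMeasure ℝ, IsDistribDeriv a b w μ :=
    (exists_isDistribDeriv hw).imp fun _ h => h.1
  rw [distribDeriv, dif_pos h]
  exact h.choose_spec

theorem distribDeriv_Icc {w : ℝ → ℝ} (hw : BoundedVariationOn w (Ioo a b)) {s t : ℝ}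
    (hs : s ∈ Ioo a b) (ht : t ∈ Ioo a b) (hst : s ≤ t) :
    distribDeriv a b w (Icc s t) = rightTrace w t - leftTrace w s := by
  obtain ⟨μ, hμ, h⟩ := exists_isDistribDeriv hw
  rw [(isDistribDeriv_distribDeriv hw).unique hμ, h s hs t ht hst]

theorem distribDeriv_singleton {w : ℝ → ℝ} (hw : BoundedVariationOn w (Ioo a b)) {x : ℝ}
    (hx : x ∈ Ioo a b) : distribDeriv a b w {x} = rightTrace w x - leftTrace w x := by
  rw [← Icc_self, distribDeriv_Icc hw hx hx le_rfl]

theorem hasSum_apply_singleton (μ : SignedMeasure ℝ) {J : Set ℝ} (hJ : J.Countable) :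
    HasSum (fun x : J => μ {(x : ℝ)}) (μ J) := by
  have := hJ.to_subtype
  have h := μ.hasSum_of_disjoint_iUnion (f := fun x : J => {(x : ℝ)}) (fun x => measurableSet_singleton _)
    (fun x y hxy => by simpa [Function.onFun] using fun h => hxy (Subtype.ext h))
  simpa using h

theorem jumpSet_countable {w : ℝ → ℝ} (hw : BoundedVariationOn w (Ioo a b)) :
    (jumpSet a b w).Countable := by
  refine (countable_not_continuousAt_of_boundedVariationOn hw).mono ?_
  rintro x hx
  refine ⟨hx.1, fun h => ?_⟩
  have hi := integrableOn_of_boundedVariationOn hw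
  exact hx.2 ((leftTrace_eq hi hx.1 (h.tendsto.mono_left nhdsWithin_le_nhds)).trans
    (rightTrace_eq hi hx.1 (h.tendsto.mono_left nhdsWithin_le_nhds)).symm)

/-- The jumps are summable over `J_w`, being the masses of the points of `J_w`; so the density in the
definition of the atomic part is integrable and no junk value occurs. -/
theorem atomicPart_eq_restrict {w : ℝ → ℝ} (hw : BoundedVariationOn w (Ioo a b)) :
    atomicPart a b w = (distribDeriv a b w).restrict (jumpSet a b w) := by
  have hJ := jumpSet_countable hw
  set J := jumpSet a b w
  have hsum : ∀ A : Set ℝ, HasSum (fun x : ↥(A ∩ J) => rightTrace w x - leftTrace w x)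
      (distribDeriv a b w (A ∩ J)) := fun A => by
    convert hasSum_apply_singleton (distribDeriv a b w) (hJ.mono (inter_subset_right (s := A)))
      using 2 with x
    exact (distribDeriv_singleton hw x.2.2.1).symm
  have hint : IntegrableOn (fun x => rightTrace w x - leftTrace w x) J Measure.count := by
    rw [← integrable_indicator_iff hJ.measurableSet, integrable_count_iff]
    have h1 : Summable ((fun x => rightTrace w x - leftTrace w x) ∘ ((↑) : J → ℝ)) :=
      (hasSum_apply_singleton (distribDeriv a b w) hJ).summable.congr
        fun x => (distribDeriv_singleton hw x.2.1)
    exact (summable_subtype_iff_indicator.1 h1).norm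
  ext A hA
  rw [VectorMeasure.restrict_apply _ hJ.measurableSet hA, atomicPart, withDensityᵥ_apply hint hA,
    Measure.restrict_restrict hA, setIntegral_countable _ (hJ.mono inter_subset_right)
      (hint.mono_set inter_subset_right), ← (hsum A).tsum_eq]
  simp [Measure.real]

/-- The set `J` may be larger than `J_w`, since `Dw` has no mass at the points of `]a,b[` outside
`J_w`. This allows one set `J` for several functions. -/
theorem diffusePart_eq_restrict {w : ℝ → ℝ} (hw : BoundedVariationOn w (Ioo a b)) {J : Set ℝ}
    (hJ : J.Countable) (hwJ : jumpSet a b w ⊆ J) (hJab : J ⊆ Ioo a b) :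
    diffusePart a b w = (distribDeriv a b w).restrict Jᶜ := by
  have h1 : diffusePart a b w = distribDeriv a b w - atomicPart a b w := by
    conv_rhs => rw [← SignedMeasure.singularPart_add_withDensity_rnDeriv_eq volume
      (distribDeriv a b w)]
    rw [diffusePart, absContPart, cantorPart]
    abel
  rw [h1, atomicPart_eq_restrict hw]
  ext A hA
  have hJw := jumpSet_countable hw
  have h2 : distribDeriv a b w (A ∩ (J \ jumpSet a b w)) = 0 := by
    rw [← (hasSum_apply_singleton (distribDeriv a b w)
      (hJ.mono (inter_subset_right.trans sdiff_subset))).tsum_eq]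
    convert tsum_zero with x
    rw [distribDeriv_singleton hw (hJab x.2.2.1), sub_eq_zero]
    by_contra h
    exact x.2.2.2 ⟨hJab x.2.2.1, fun h' => h h'.symm⟩
  have h3 : distribDeriv a b w A = distribDeriv a b w (A ∩ jumpSet a b w)
      + distribDeriv a b w (A ∩ (J \ jumpSet a b w)) + distribDeriv a b w (A ∩ Jᶜ) := by
    rw [← VectorMeasure.of_union, ← VectorMeasure.of_union]
    · congr 1
      ext x
      have := @hwJ x
      simp only [mem_union, mem_inter_iff, Set.mem_sdiff, mem_compl_iff]
      tauto
    · rw [disjoint_left]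
      rintro x (hx | hx) hx'
      · exact hx'.2 (hwJ hx.2)
      · exact hx'.2 hx.2.1
    · exact (hA.inter hJw.measurableSet).union (hA.inter (hJ.measurableSet.diff hJw.measurableSet))
    · exact hA.inter hJ.measurableSet.compl
    · rw [disjoint_left]
      rintro x hx hx'
      exact hx'.2.2 hx.2
    · exact hA.inter hJw.measurableSet
    · exact hA.inter (hJ.measurableSet.diff hJw.measurableSet)
  rw [sub_apply, VectorMeasure.restrict_apply _ hJw.measurableSet hA,
    VectorMeasure.restrict_apply _ hJ.measurableSet.compl hA, h3, h2]
  ring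

theorem restrict_withDensityᵥ {X : Type*} [MeasurableSpace X] {σ : Measure X} {g : X → ℝ}
    (hg : Integrable g σ) {s : Set X} (hs : MeasurableSet s) :
    (σ.withDensityᵥ g).restrict s = σ.withDensityᵥ (s.indicator g) := by
  ext A hA
  rw [VectorMeasure.restrict_apply _ hs hA, withDensityᵥ_apply hg (hA.inter hs),
    withDensityᵥ_apply (hg.indicator hs) hA, setIntegral_indicator hs]

theorem variation_singleton_eq_zero {X : Type*} [MeasurableSpace X] [MeasurableSingletonClass X]
    {μ : SignedMeasure X} {x : X} (h : μ {x} = 0) : μ.variation {x} = 0 := by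
  rw [VectorMeasure.variation_apply_eq_zero (measurableSet_singleton x)]
  intro t ht _
  rcases subset_singleton_iff_eq.1 ht with rfl | rfl
  · exact VectorMeasure.empty _
  · exact h

theorem IsDistribDeriv.variation_compl_Ioo {w : ℝ → ℝ} {μ : SignedMeasure ℝ}
    (h : IsDistribDeriv a b w μ) : μ.variation (Ioo a b)ᶜ = 0 := by
  rw [← h.1, VectorMeasure.variation_restrict measurableSet_Ioo]
  simp [Measure.restrict_apply]

/-! ### Traces of vector valued functions -/

/-- One-sided limits taken near a point of continuity are close to the value at that point. -/
theorem tendsto_of_continuousAt_of_tendsto_near {E : Type*} [NormedAddCommGroup E] {u T : ℝ → E}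
    {x : ℝ} (hT : ∀ᶠ y in 𝓝 x, ∃ l : Filter ℝ, l.NeBot ∧ l ≤ 𝓝 y ∧ Tendsto u l (𝓝 (T y)))
    (hu : ContinuousAt u x) : Tendsto T (𝓝 x) (𝓝 (u x)) := by
  refine (closed_nhds_basis (u x)).tendsto_right_iff.2 fun s hs => ?_
  filter_upwards [hT, eventually_eventually_nhds.2 (hu hs.1)] with y ⟨l, hl, hly, hlim⟩ hy
  exact hs.2.mem_of_tendsto hlim (hly hy)

theorem tendsto_rightTrace_of_continuousAt {E : Type*} [NormedAddCommGroup E] [NormedSpace ℝ E]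
    [CompleteSpace E] {u : ℝ → E} (hv : BoundedVariationOn u (Ioo a b))
    (hu : IntegrableOn u (Ioo a b)) {x : ℝ} (hx : x ∈ Ioo a b) (hc : ContinuousAt u x) :
    Tendsto (rightTrace u) (𝓝 x) (𝓝 (u x)) := by
  refine tendsto_of_continuousAt_of_tendsto_near ?_ hc
  filter_upwards [Ioo_mem_nhds hx.1 hx.2] with y hy
  exact ⟨𝓝[>] y, inferInstance, nhdsWithin_le_nhds, tendsto_rightTrace hv hu hy⟩

theorem tendsto_leftTrace_of_continuousAt {E : Type*} [NormedAddCommGroup E] [NormedSpace ℝ E]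
    [CompleteSpace E] {u : ℝ → E} (hv : BoundedVariationOn u (Ioo a b))
    (hu : IntegrableOn u (Ioo a b)) {x : ℝ} (hx : x ∈ Ioo a b) (hc : ContinuousAt u x) :
    Tendsto (leftTrace u) (𝓝 x) (𝓝 (u x)) := by
  refine tendsto_of_continuousAt_of_tendsto_near ?_ hc
  filter_upwards [Ioo_mem_nhds hx.1 hx.2] with y hy
  exact ⟨𝓝[<] y, inferInstance, nhdsWithin_le_nhds, tendsto_leftTrace hv hu hy⟩

theorem boundedVariationOn_coord {u : ℝ → EuclideanSpace ℝ (Fin d)} {s : Set ℝ}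
    (hv : BoundedVariationOn u s) (i : Fin d) : BoundedVariationOn (fun x => u x i) s :=
  ((EuclideanSpace.proj i : EuclideanSpace ℝ (Fin d) →L[ℝ] ℝ).lipschitz).comp_boundedVariationOn hv

theorem rightTrace_coord {u : ℝ → EuclideanSpace ℝ (Fin d)} (hv : BoundedVariationOn u (Ioo a b))
    (hu : IntegrableOn u (Ioo a b)) {x : ℝ} (hx : x ∈ Ioo a b) (i : Fin d) :
    rightTrace (fun x => u x i) x = rightTrace u x i :=
  rightTrace_eq (integrableOn_of_boundedVariationOn (boundedVariationOn_coord hv i)) hx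
    (((EuclideanSpace.proj i : EuclideanSpace ℝ (Fin d) →L[ℝ] ℝ).continuous.tendsto _).comp
      (tendsto_rightTrace hv hu hx))

theorem leftTrace_coord {u : ℝ → EuclideanSpace ℝ (Fin d)} (hv : BoundedVariationOn u (Ioo a b))
    (hu : IntegrableOn u (Ioo a b)) {x : ℝ} (hx : x ∈ Ioo a b) (i : Fin d) :
    leftTrace (fun x => u x i) x = leftTrace u x i :=
  leftTrace_eq (integrableOn_of_boundedVariationOn (boundedVariationOn_coord hv i)) hx
    (((EuclideanSpace.proj i : EuclideanSpace ℝ (Fin d) →L[ℝ] ℝ).continuous.tendsto _).comp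
      (tendsto_leftTrace hv hu hx))

theorem jumpSet_eq_iUnion_coord {u : ℝ → EuclideanSpace ℝ (Fin d)}
    (hv : BoundedVariationOn u (Ioo a b)) (hu : IntegrableOn u (Ioo a b)) :
    jumpSet a b u = ⋃ i, jumpSet a b (fun x => u x i) := by
  ext x
  simp only [jumpSet, mem_iUnion, mem_ofPred_eq]
  constructor
  · rintro ⟨hx, h⟩
    obtain ⟨i, hi⟩ : ∃ i, leftTrace u x i ≠ rightTrace u x i := by
      by_contra! hcon
      exact h (by ext i; exact hcon i)
    exact ⟨i, hx, by rwa [leftTrace_coord hv hu hx, rightTrace_coord hv hu hx]⟩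
  · rintro ⟨i, hx, h⟩
    rw [leftTrace_coord hv hu hx, rightTrace_coord hv hu hx] at h
    exact ⟨hx, fun h' => h (by rw [h'])⟩

theorem countable_not_continuousAt_euclidean {u : ℝ → EuclideanSpace ℝ (Fin d)}
    (hv : BoundedVariationOn u (Ioo a b)) : {x ∈ Ioo a b | ¬ContinuousAt u x}.Countable := by
  refine (countable_iUnion fun i => countable_not_continuousAt_of_boundedVariationOn
    (boundedVariationOn_coord hv i)).mono fun x hx => ?_
  by_contra hcon
  simp only [mem_iUnion, mem_ofPred_eq, not_exists, not_and, not_not] at hcon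
  refine hx.2 ?_
  have h : ContinuousAt (fun x i => u x i) x := continuousAt_pi.2 fun i => hcon i hx.1
  exact (PiLp.continuous_toLp 2 _).continuousAt.comp h

theorem exists_measurable_eqOn_euclidean {u : ℝ → EuclideanSpace ℝ (Fin d)} {s : Set ℝ}
    (hv : BoundedVariationOn u s) : ∃ U : ℝ → EuclideanSpace ℝ (Fin d), Measurable U ∧ EqOn U u s := by
  choose W _ hWm _ hWw using fun i =>
    exists_boundedVariationOn_univ_extension (boundedVariationOn_coord hv i)
  refine ⟨fun x => WithLp.toLp 2 fun i => W i x, ?_, fun x hx => ?_⟩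
  · exact (PiLp.continuous_toLp 2 _).measurable.comp (measurable_pi_lambda _ hWm)
  · ext i
    exact hWw i hx

/-! ### Differentiating measures along shrinking balls -/

/-- If the increments `p - q`, rescaled by `c`, converge to `G`, then the rescaled increments of `F`
converge to `F' G`. The factor `c` need not tend to infinity. -/
theorem tendsto_mul_sub_of_hasStrictFDerivAt {E ι : Type*} [NormedAddCommGroup E]
    [NormedSpace ℝ E] {l : Filter ι} {F : E → ℝ} {F' : E →L[ℝ] ℝ} {z G : E}
    (hF : HasStrictFDerivAt F F' z) {p q : ι → E} {c : ι → ℝ} (hp : Tendsto p l (𝓝 z))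
    (hq : Tendsto q l (𝓝 z)) (hG : Tendsto (fun r => c r • (p r - q r)) l (𝓝 G)) :
    Tendsto (fun r => c r * (F (p r) - F (q r))) l (𝓝 (F' G)) := by
  have h1 : (fun r => F (p r) - F (q r) - F' (p r - q r)) =o[l] fun r => p r - q r :=
    hF.isLittleO.comp_tendsto (hp.prodMk_nhds hq)
  have h2 : (fun r => c r • (F (p r) - F (q r) - F' (p r - q r))) =o[l]
      fun r => c r • (p r - q r) := (Asymptotics.isBigO_refl c l).smul_isLittleO h1
  have h3 : Tendsto (fun r => c r • (F (p r) - F (q r) - F' (p r - q r))) l (𝓝 0) :=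
    (Asymptotics.isLittleO_one_iff ℝ).1 (h2.trans_isBigO (hG.isBigO_one ℝ))
  have h4 : Tendsto (fun r => F' (c r • (p r - q r))) l (𝓝 (F' G)) :=
    (F'.continuous.tendsto _).comp hG
  have h5 := h3.add h4
  rw [zero_add] at h5
  refine h5.congr fun r => ?_
  simp only [map_smul, smul_eq_mul]
  ring

/-- Besicovitch differentiation of a signed measure `g σ` with respect to `σ`. An interval with
`σ`-mass zero contributes the quotient `0`, in agreement with the convention for averages. -/
theorem ae_tendsto_inv_mul_apply_Icc {σ : Measure ℝ} [IsFiniteMeasure σ] {μ : SignedMeasure ℝ}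
    {g : ℝ → ℝ} (hg : Integrable g σ) (hμ : μ = σ.withDensityᵥ g) :
    ∀ᵐ x ∂σ, Tendsto (fun r => (σ.real (Icc (x - r) (x + r)))⁻¹ * μ (Icc (x - r) (x + r)))
      (𝓝[>] 0) (𝓝 (g x)) := by
  filter_upwards [(Besicovitch.vitaliFamily σ).ae_tendsto_average hg.locallyIntegrable] with x hx
  refine (hx.comp (Besicovitch.tendsto_filterAt σ x)).congr fun r => ?_
  simp only [Function.comp, Real.closedBall_eq_Icc]
  rw [hμ, withDensityᵥ_apply hg measurableSet_Icc, setAverage_eq, smul_eq_mul]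

/-! ### Partial derivatives -/

theorem hasFDerivAt_uncurry {f : ℝ → EuclideanSpace ℝ (Fin d) → ℝ}
    (hf : ContDiff ℝ 1 (fun p : ℝ × EuclideanSpace ℝ (Fin d) => f p.1 p.2))
    (p : ℝ × EuclideanSpace ℝ (Fin d)) :
    HasFDerivAt (fun p : ℝ × EuclideanSpace ℝ (Fin d) => f p.1 p.2)
      (fderiv ℝ (fun p : ℝ × EuclideanSpace ℝ (Fin d) => f p.1 p.2) p) p :=
  (hf.differentiable one_ne_zero p).hasFDerivAt

theorem partialY_eq_fderiv {f : ℝ → EuclideanSpace ℝ (Fin d) → ℝ}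
    (hf : ContDiff ℝ 1 (fun p : ℝ × EuclideanSpace ℝ (Fin d) => f p.1 p.2)) (y : ℝ)
    (w : EuclideanSpace ℝ (Fin d)) : partialY f y w =
      fderiv ℝ (fun p : ℝ × EuclideanSpace ℝ (Fin d) => f p.1 p.2) (y, w) (1, 0) := by
  have h : HasDerivAt (fun t : ℝ => (t, w)) ((1 : ℝ), (0 : EuclideanSpace ℝ (Fin d))) y :=
    (hasDerivAt_id y).prodMk (hasDerivAt_const y w)
  exact ((hasFDerivAt_uncurry hf (y, w)).comp_hasDerivAt y h).deriv

theorem partialW_eq_fderiv {f : ℝ → EuclideanSpace ℝ (Fin d) → ℝ}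
    (hf : ContDiff ℝ 1 (fun p : ℝ × EuclideanSpace ℝ (Fin d) => f p.1 p.2)) (y : ℝ)
    (w : EuclideanSpace ℝ (Fin d)) (i : Fin d) : partialW f y w i =
      fderiv ℝ (fun p : ℝ × EuclideanSpace ℝ (Fin d) => f p.1 p.2) (y, w)
        (0, EuclideanSpace.single i 1) := by
  have h : HasFDerivAt (fun w' : EuclideanSpace ℝ (Fin d) => (y, w'))
      (ContinuousLinearMap.inr ℝ ℝ (EuclideanSpace ℝ (Fin d))) w := hasFDerivAt_prodMk_right y w
  have h2 := ((hasFDerivAt_uncurry hf (y, w)).comp w h).fderiv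
  have h3 : partialW f y w i = inner ℝ (gradient (f y) w) (EuclideanSpace.single i 1) := by
    rw [EuclideanSpace.inner_single_right]
    simp [partialW]
  rw [h3, inner_gradient_left]
  have h4 : f y = (fun p : ℝ × EuclideanSpace ℝ (Fin d) => f p.1 p.2) ∘ fun w' => (y, w') := rfl
  rw [h4, h2]
  simp

theorem fderiv_uncurry_apply {f : ℝ → EuclideanSpace ℝ (Fin d) → ℝ}
    (hf : ContDiff ℝ 1 (fun p : ℝ × EuclideanSpace ℝ (Fin d) => f p.1 p.2)) (y : ℝ)
    (w : EuclideanSpace ℝ (Fin d)) (s : ℝ) (v : EuclideanSpace ℝ (Fin d)) :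
    fderiv ℝ (fun p : ℝ × EuclideanSpace ℝ (Fin d) => f p.1 p.2) (y, w) (s, v) =
      partialY f y w * s + ∑ i, partialW f y w i * v i := by
  simp only [partialY_eq_fderiv hf, partialW_eq_fderiv hf]
  set L := fderiv ℝ (fun p : ℝ × EuclideanSpace ℝ (Fin d) => f p.1 p.2) (y, w)
  have h1 : (s, v) = s • ((1 : ℝ), (0 : EuclideanSpace ℝ (Fin d)))
      + ∑ i, v i • ((0 : ℝ), EuclideanSpace.single i (1 : ℝ)) := by
    refine Prod.ext ?_ ?_
    · simp [Prod.fst_sum]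
    · ext j
      simp [Prod.snd_sum, Finset.sum_apply, Pi.single_apply]
  simp only [h1, map_add, map_sum, map_smul, smul_eq_mul]
  simp only [mul_comm]

/-! ### The chain rule -/

theorem boundedVariationOn_comp {f : ℝ → EuclideanSpace ℝ (Fin d) → ℝ}
    (hf : ContDiff ℝ 1 (fun p : ℝ × EuclideanSpace ℝ (Fin d) => f p.1 p.2)) {K : ℝ → ℝ}
    {u : ℝ → EuclideanSpace ℝ (Fin d)} {s : Set ℝ} (hK : BoundedVariationOn K s)
    (hu : BoundedVariationOn u s) : BoundedVariationOn (fun x => f (K x) (u x)) s := by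
  obtain ⟨C, hC⟩ := exists_bound_of_boundedVariationOn hK
  obtain ⟨D, hD⟩ := exists_bound_of_boundedVariationOn hu
  set F : ℝ × EuclideanSpace ℝ (Fin d) → ℝ := fun p => f p.1 p.2
  set B := Metric.closedBall (0 : ℝ × EuclideanSpace ℝ (Fin d)) (max C D)
  have hmem : ∀ x ∈ s, (K x, u x) ∈ B := fun x hx => by
    rw [mem_closedBall_zero_iff, Prod.norm_def]
    exact max_le_max (hC x hx) (hD x hx)
  obtain ⟨M, hM⟩ := (isCompact_closedBall (0 : ℝ × EuclideanSpace ℝ (Fin d))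
    (max C D)).exists_bound_of_continuousOn (hf.continuous_fderiv one_ne_zero).continuousOn
  have hlip : LipschitzOnWith M.toNNReal F B :=
    (convex_closedBall _ _).lipschitzOnWith_of_nnnorm_fderiv_le
      (fun p _ => hf.differentiable one_ne_zero p) fun p hp => by
        rw [← NNReal.coe_le_coe, coe_nnnorm]
        exact (hM p hp).trans (Real.le_coe_toNNReal M)
  refine boundedVariationOn_of_edist_le (C := M.toNNReal) hK hu fun x hx y hy => ?_
  refine (hlip (hmem x hx) (hmem y hy)).trans ?_
  gcongr
  rw [Prod.edist_eq]
  exact max_le le_self_add le_add_self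

theorem rightTrace_comp {f : ℝ → EuclideanSpace ℝ (Fin d) → ℝ}
    (hf : ContDiff ℝ 1 (fun p : ℝ × EuclideanSpace ℝ (Fin d) => f p.1 p.2)) {K : ℝ → ℝ}
    {u : ℝ → EuclideanSpace ℝ (Fin d)} (hK : BoundedVariationOn K (Ioo a b))
    (hu : BoundedVariationOn u (Ioo a b)) (hui : IntegrableOn u (Ioo a b)) {x : ℝ}
    (hx : x ∈ Ioo a b) : rightTrace (fun x => f (K x) (u x)) x =
      f (rightTrace K x) (rightTrace u x) :=
  rightTrace_eq (integrableOn_of_boundedVariationOn (boundedVariationOn_comp hf hK hu)) hx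
    ((hf.continuous.tendsto (rightTrace K x, rightTrace u x)).comp
      ((tendsto_rightTrace hK (integrableOn_of_boundedVariationOn hK) hx).prodMk_nhds
        (tendsto_rightTrace hu hui hx)))

theorem leftTrace_comp {f : ℝ → EuclideanSpace ℝ (Fin d) → ℝ}
    (hf : ContDiff ℝ 1 (fun p : ℝ × EuclideanSpace ℝ (Fin d) => f p.1 p.2)) {K : ℝ → ℝ}
    {u : ℝ → EuclideanSpace ℝ (Fin d)} (hK : BoundedVariationOn K (Ioo a b))
    (hu : BoundedVariationOn u (Ioo a b)) (hui : IntegrableOn u (Ioo a b)) {x : ℝ}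
    (hx : x ∈ Ioo a b) : leftTrace (fun x => f (K x) (u x)) x =
      f (leftTrace K x) (leftTrace u x) :=
  leftTrace_eq (integrableOn_of_boundedVariationOn (boundedVariationOn_comp hf hK hu)) hx
    ((hf.continuous.tendsto (leftTrace K x, leftTrace u x)).comp
      ((tendsto_leftTrace hK (integrableOn_of_boundedVariationOn hK) hx).prodMk_nhds
        (tendsto_leftTrace hu hui hx)))

/-- Finite pointwise variation bounds `TV(w)`, here by the total variation of `Dw`. -/
theorem isBV_of_boundedVariationOn {w : ℝ → ℝ} (hw : BoundedVariationOn w (Ioo a b)) :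
    IsBV a b w := by
  refine ⟨integrableOn_of_boundedVariationOn hw, ?_⟩
  set μ := distribDeriv a b w
  refine lt_of_le_of_lt (iSup_le fun φ => iSup_le fun hφ => iSup_le fun h1 => ?_)
    (ENNReal.ofReal_lt_top (r := 1 * ‖(ContinuousLinearMap.lsmul ℝ ℝ (E := ℝ)).flip‖ *
      μ.variation.real univ))
  refine ENNReal.ofReal_le_ofReal ?_
  have h2 : ∫ x in Ioo a b, inner ℝ (w x) (deriv φ x) = -∫ᵛ x, φ x ∂<•μ := by
    rw [← (isDistribDeriv_distribDeriv hw).2 φ hφ]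
    simp [mul_comm]
  rw [h2]
  refine (neg_le_abs _).trans ?_
  exact VectorMeasure.norm_integral_le_of_norm_le_const (μ := μ) (f := φ)
    (B := (ContinuousLinearMap.lsmul ℝ ℝ (E := ℝ)).flip) (Eventually.of_forall h1)

/-- At a point of continuity of `K` and `u` where all the densities are limits of quotients over
shrinking balls, strict differentiability of `f` transfers to the densities. -/
theorem density_comp_eq {f : ℝ → EuclideanSpace ℝ (Fin d) → ℝ}
    (hf : ContDiff ℝ 1 (fun p : ℝ × EuclideanSpace ℝ (Fin d) => f p.1 p.2)) {K : ℝ → ℝ}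
    {u : ℝ → EuclideanSpace ℝ (Fin d)} (hK : BoundedVariationOn K (Ioo a b))
    (hu : BoundedVariationOn u (Ioo a b)) (hui : IntegrableOn u (Ioo a b)) {x : ℝ}
    (hx : x ∈ Ioo a b) (hKc : ContinuousAt K x) (huc : ContinuousAt u x) {c : ℝ → ℝ}
    {k g : ℝ} {v : Fin d → ℝ}
    (hk : Tendsto (fun r => c r * distribDeriv a b K (Icc (x - r) (x + r))) (𝓝[>] 0) (𝓝 k))
    (hv : ∀ i, Tendsto (fun r => c r * distribDeriv a b (fun x => u x i) (Icc (x - r) (x + r)))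
      (𝓝[>] 0) (𝓝 (v i)))
    (hg : Tendsto (fun r => c r * distribDeriv a b (fun x => f (K x) (u x))
      (Icc (x - r) (x + r))) (𝓝[>] 0) (𝓝 g)) :
    g = partialY f (K x) (u x) * k + ∑ i, partialW f (K x) (u x) i * v i := by
  have hplus : Tendsto (fun r : ℝ => x + r) (𝓝[>] 0) (𝓝 x) :=
    (by simpa using (continuous_const_add x).tendsto 0 :
      Tendsto (fun r : ℝ => x + r) (𝓝 0) (𝓝 x)).mono_left nhdsWithin_le_nhds
  have hminus : Tendsto (fun r : ℝ => x - r) (𝓝[>] 0) (𝓝 x) :=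
    (by simpa using (continuous_sub_left x).tendsto 0 :
      Tendsto (fun r : ℝ => x - r) (𝓝 0) (𝓝 x)).mono_left nhdsWithin_le_nhds
  have hKi := integrableOn_of_boundedVariationOn hK
  have hp : Tendsto (fun r => (rightTrace K (x + r), rightTrace u (x + r))) (𝓝[>] 0)
      (𝓝 (K x, u x)) :=
    ((tendsto_rightTrace_of_continuousAt hK hKi hx hKc).comp hplus).prodMk_nhds
      ((tendsto_rightTrace_of_continuousAt hu hui hx huc).comp hplus)
  have hq : Tendsto (fun r => (leftTrace K (x - r), leftTrace u (x - r))) (𝓝[>] 0)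
      (𝓝 (K x, u x)) :=
    ((tendsto_leftTrace_of_continuousAt hK hKi hx hKc).comp hminus).prodMk_nhds
      ((tendsto_leftTrace_of_continuousAt hu hui hx huc).comp hminus)
  have hnear : ∀ᶠ r in 𝓝[>] (0 : ℝ), x - r ∈ Ioo a b ∧ x + r ∈ Ioo a b ∧ x - r ≤ x + r := by
    filter_upwards [hplus (Ioo_mem_nhds hx.1 hx.2), hminus (Ioo_mem_nhds hx.1 hx.2),
      self_mem_nhdsWithin] with r h1 h2 h3
    exact ⟨h2, h1, by linarith [mem_Ioi.1 h3]⟩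
  have hG : Tendsto (fun r => c r • ((rightTrace K (x + r), rightTrace u (x + r)) -
      (leftTrace K (x - r), leftTrace u (x - r)))) (𝓝[>] 0) (𝓝 (k, WithLp.toLp 2 v)) := by
    have h1 : Tendsto (fun r => WithLp.toLp 2 fun i =>
        c r * distribDeriv a b (fun x => u x i) (Icc (x - r) (x + r))) (𝓝[>] 0)
        (𝓝 (WithLp.toLp 2 v : EuclideanSpace ℝ (Fin d))) :=
      ((PiLp.continuous_toLp 2 _).tendsto v).comp (tendsto_pi_nhds.2 hv)
    refine (hk.prodMk_nhds h1).congr' ?_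
    filter_upwards [hnear] with r ⟨h2, h3, h4⟩
    refine Prod.ext ?_ ?_
    · simp [distribDeriv_Icc hK h2 h3 h4]
    · ext i
      simp [distribDeriv_Icc (boundedVariationOn_coord hu i) h2 h3 h4, rightTrace_coord hu hui h3,
        leftTrace_coord hu hui h2]
  have hlim := tendsto_mul_sub_of_hasStrictFDerivAt
    (hf.contDiffAt.hasStrictFDerivAt one_ne_zero) hp hq hG
  rw [fderiv_uncurry_apply hf] at hlim
  refine tendsto_nhds_unique hg (hlim.congr' ?_)
  filter_upwards [hnear] with r ⟨h2, h3, h4⟩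
  rw [distribDeriv_Icc (boundedVariationOn_comp hf hK hu) h2 h3 h4, rightTrace_comp hf hK hu hui h3,
    leftTrace_comp hf hK hu hui h2]

end BVChain

open BVChain

theorem corollary4p6 {d : ℕ} {a b : ℝ} (hab : a < b)
    (f : ℝ → EuclideanSpace ℝ (Fin d) → ℝ) (K : ℝ → ℝ)
    (hK : BVChain.IsBV a b K) (hKgood : BVChain.IsGoodRepresentative a b K)
    (hf : ContDiff ℝ 1 (fun p : ℝ × EuclideanSpace ℝ (Fin d) => f p.1 p.2))
    (hfw : ∀ w : EuclideanSpace ℝ (Fin d),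
      BVChain.IsBV a b (fun x => BVChain.partialW f (K x) w))
    (hLip : ∀ D : Set (ℝ × EuclideanSpace ℝ (Fin d)), IsCompact D → ∃ L : ℝ,
      (∀ y w w', (y, w) ∈ D → (y, w') ∈ D →
        |BVChain.partialY f y w - BVChain.partialY f y w'| ≤ L * ‖w - w'‖) ∧
      (∀ y y' w, (y, w) ∈ D → (y', w) ∈ D →
        ‖BVChain.partialW f y w - BVChain.partialW f y' w‖ ≤ L * |y - y'|))
    (u : ℝ → EuclideanSpace ℝ (Fin d))
    (hu : BVChain.IsBV a b u) (hugood : BVChain.IsGoodRepresentative a b u) :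
    BVChain.IsBV a b (fun x => f (K x) (u x)) ∧
    (BVChain.diffusePart a b K).Integrable (fun x => BVChain.partialY f (K x) (u x)) ∧
    (∀ i : Fin d, (BVChain.diffusePart a b (fun x => u x i)).Integrable
      (fun x => BVChain.partialW f (K x) (u x) i)) ∧
    Summable (fun x : ↥(BVChain.jumpSet a b u ∪ BVChain.jumpSet a b K) =>
      f (BVChain.rightTrace K x) (BVChain.rightTrace u x)
        - f (BVChain.leftTrace K x) (BVChain.leftTrace u x)) ∧
    ∀ φ : ℝ → ℝ, BVChain.IsTestFunction a b φ →
      ∫ x in Ioo a b, deriv φ x * f (K x) (u x) =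
        - (∫ᵛ x, φ x * BVChain.partialY f (K x) (u x) ∂<•(BVChain.diffusePart a b K))
        - (∑ i : Fin d, ∫ᵛ x, φ x * BVChain.partialW f (K x) (u x) i
            ∂<•(BVChain.diffusePart a b (fun x => u x i)))
        - ∑' x : ↥(BVChain.jumpSet a b u ∪ BVChain.jumpSet a b K),
            φ x * (f (BVChain.rightTrace K x) (BVChain.rightTrace u x)
              - f (BVChain.leftTrace K x) (BVChain.leftTrace u x)) := by
  have hKv : BoundedVariationOn K (Ioo a b) := by
    rw [BoundedVariationOn, hKgood]; exact hK.2.ne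
  have huv : BoundedVariationOn u (Ioo a b) := by
    rw [BoundedVariationOn, hugood]; exact hu.2.ne
  have hui := hu.1
  have hcv := fun i => boundedVariationOn_coord huv i
  have hvv := boundedVariationOn_comp hf hKv huv
  have hJu := jumpSet_eq_iUnion_coord huv hui
  set J := jumpSet a b u ∪ jumpSet a b K with hJdef
  have hJ : J.Countable := by
    rw [hJdef, hJu]
    exact (countable_iUnion fun i => jumpSet_countable (hcv i)).union (jumpSet_countable hKv)
  have hJab : J ⊆ Ioo a b := union_subset (fun x hx => hx.1) fun x hx => hx.1
  have hJm := hJ.measurableSet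
  set μK := distribDeriv a b K with hμK
  set μu := fun i => distribDeriv a b (fun x => u x i) with hμu
  set μv := distribDeriv a b (fun x => f (K x) (u x)) with hμv
  set σ : Measure ℝ := μK.variation + ∑ i, (μu i).variation + μv.variation with hσ
  have hKσ : μK.variation ≤ σ := Measure.le_add_right (Measure.le_add_right le_rfl)
  have huσ : ∀ i, (μu i).variation ≤ σ := fun i => Measure.le_add_right (Measure.le_add_left
    (Finset.single_le_sum (f := fun i => (μu i).variation) (fun _ _ => Measure.zero_le _)
      (Finset.mem_univ i)))
  have hvσ : μv.variation ≤ σ := Measure.le_add_left le_rfl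
  have hσ0 : ∀ s : Set ℝ, μK.variation s = 0 → (∀ i, (μu i).variation s = 0) →
      μv.variation s = 0 → σ s = 0 := fun s h1 h2 h3 => by
    simp [hσ, h1, h2, h3]
  obtain ⟨gK, hgK, hμgK⟩ := exists_eq_withDensityᵥ μK hKσ
  choose gu hgu hμgu using fun i => exists_eq_withDensityᵥ (μu i) (huσ i)
  obtain ⟨gv, hgv, hμgv⟩ := exists_eq_withDensityᵥ μv hvσ
  have hσab : ∀ᵐ x ∂σ, x ∈ Ioo a b :=
    hσ0 _ (isDistribDeriv_distribDeriv hKv).variation_compl_Ioo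
      (fun i => (isDistribDeriv_distribDeriv (hcv i)).variation_compl_Ioo)
      (isDistribDeriv_distribDeriv hvv).variation_compl_Ioo
  have hσpt : ∀ x ∈ Ioo a b, x ∉ J → σ {x} = 0 := by
    intro x hx hxJ
    have hK0 : leftTrace K x = rightTrace K x := by
      by_contra h
      exact hxJ (Or.inr ⟨hx, h⟩)
    have hu0 : leftTrace u x = rightTrace u x := by
      by_contra h
      exact hxJ (Or.inl ⟨hx, h⟩)
    refine hσ0 _ (variation_singleton_eq_zero ?_) (fun i => variation_singleton_eq_zero ?_)
      (variation_singleton_eq_zero ?_)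
    · rw [hμK, distribDeriv_singleton hKv hx, hK0, sub_self]
    · simp only [hμu]
      rw [distribDeriv_singleton (hcv i) hx, leftTrace_coord huv hui hx,
        rightTrace_coord huv hui hx, hu0, sub_self]
    · rw [hμv, distribDeriv_singleton hvv hx, leftTrace_comp hf hKv huv hui hx,
        rightTrace_comp hf hKv huv hui hx, hK0, hu0, sub_self]
  -- Discontinuities outside `J` are countably many points without mass.
  have hcont : ∀ᵐ x ∂σ, x ∉ J → ContinuousAt K x ∧ ContinuousAt u x := by
    set N := {x ∈ Ioo a b | ¬ContinuousAt K x} ∪ {x ∈ Ioo a b | ¬ContinuousAt u x} with hN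
    have hNc : N.Countable := (countable_not_continuousAt_of_boundedVariationOn hKv).union
      (countable_not_continuousAt_euclidean huv)
    have hN0 : σ (N \ J) = 0 := by
      rw [← biUnion_of_singleton (N \ J), measure_biUnion_null_iff (hNc.mono sdiff_subset)]
      rintro x ⟨hx | hx, hxJ⟩
      · exact hσpt x hx.1 hxJ
      · exact hσpt x hx.1 hxJ
    filter_upwards [hσab, measure_eq_zero_iff_ae_notMem.1 hN0] with x hx hxN hxJ
    by_contra hcon
    refine hxN ⟨?_, hxJ⟩
    by_cases h : ContinuousAt K x
    · exact Or.inr ⟨hx, fun h' => hcon ⟨h, h'⟩⟩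
    · exact Or.inl ⟨hx, h⟩
  have hdens : ∀ᵐ x ∂σ, x ∉ J →
      gv x = partialY f (K x) (u x) * gK x + ∑ i, partialW f (K x) (u x) i * gu i x := by
    filter_upwards [hσab, hcont, ae_tendsto_inv_mul_apply_Icc hgK hμgK,
      ae_all_iff.2 fun i => ae_tendsto_inv_mul_apply_Icc (hgu i) (hμgu i),
      ae_tendsto_inv_mul_apply_Icc hgv hμgv] with x hx hc h1 h2 h3 hxJ
    exact density_comp_eq hf hKv huv hui hx (hc hxJ).1 (hc hxJ).2 h1 h2 h3
  set D := fderiv ℝ (fun p : ℝ × EuclideanSpace ℝ (Fin d) => f p.1 p.2)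
  have hD : Continuous D := hf.continuous_fderiv one_ne_zero
  -- `K` and `u` need not be measurable outside `]a,b[`, which is a null set for `σ`.
  have hz : AEMeasurable (fun x => (K x, u x)) σ := by
    obtain ⟨K', -, hK'm, -, hK'⟩ := exists_boundedVariationOn_univ_extension hKv
    obtain ⟨u', hu'm, hu'⟩ := exists_measurable_eqOn_euclidean huv
    refine ⟨fun x => (K' x, u' x), hK'm.prodMk hu'm, ?_⟩
    filter_upwards [hσab] with x hx
    rw [hK' hx, hu' hx]
  obtain ⟨M, hM⟩ : ∃ M, ∀ x ∈ Ioo a b, ‖D (K x, u x)‖ ≤ M := by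
    obtain ⟨C, hC⟩ := exists_bound_of_boundedVariationOn hKv
    obtain ⟨C', hC'⟩ := exists_bound_of_boundedVariationOn huv
    obtain ⟨M, hM⟩ := (isCompact_closedBall (0 : ℝ × EuclideanSpace ℝ (Fin d))
      (max C C')).exists_bound_of_continuousOn hD.continuousOn
    refine ⟨M, fun x hx => hM _ ?_⟩
    rw [mem_closedBall_zero_iff, Prod.norm_def]
    exact max_le_max (hC x hx) (hC' x hx)
  have hDm : ∀ e, AEStronglyMeasurable (fun x => D (K x, u x) e) σ := fun e =>
    ((hD.clm_apply continuous_const).measurable.comp_aemeasurable hz).aestronglyMeasurable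
  have hDb : ∀ e, ∀ᵐ x ∂σ, ‖D (K x, u x) e‖ ≤ M * ‖e‖ := fun e => by
    filter_upwards [hσab] with x hx
    exact ((D (K x, u x)).le_opNorm e).trans (by gcongr; exact hM x hx)
  have hYm : AEStronglyMeasurable (fun x => partialY f (K x) (u x)) σ := by
    simpa only [partialY_eq_fderiv hf] using hDm (1, 0)
  have hWm : ∀ i, AEStronglyMeasurable (fun x => partialW f (K x) (u x) i) σ := fun i => by
    simpa only [partialW_eq_fderiv hf] using hDm (0, EuclideanSpace.single i 1)
  have hYi : ∀ g, Integrable g σ → Integrable (fun x => partialY f (K x) (u x) * g x) σ :=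
    fun g hg => hg.bdd_mul hYm (by simpa only [partialY_eq_fderiv hf] using hDb (1, 0))
  have hWi : ∀ i g, Integrable g σ → Integrable (fun x => partialW f (K x) (u x) i * g x) σ :=
    fun i g hg => hg.bdd_mul (hWm i)
      (by simpa only [partialW_eq_fderiv hf] using hDb (0, EuclideanSpace.single i 1))
  have hdK : diffusePart a b K = σ.withDensityᵥ (Jᶜ.indicator gK) := by
    rw [diffusePart_eq_restrict hKv hJ subset_union_right hJab, ← hμK, hμgK,
      restrict_withDensityᵥ hgK hJm.compl]
  have hdu : ∀ i, diffusePart a b (fun x => u x i) = σ.withDensityᵥ (Jᶜ.indicator (gu i)) := by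
    intro i
    rw [diffusePart_eq_restrict (hcv i) hJ
      ((hJu ▸ subset_iUnion (fun i => jumpSet a b fun x => u x i) i).trans subset_union_left) hJab,
      ← restrict_withDensityᵥ (hgu i) hJm.compl, ← hμgu i]
  have hgK' := hgK.indicator hJm.compl
  have hgu' := fun i => (hgu i).indicator hJm.compl
  have hjump : ∀ x ∈ J, μv {x} = f (rightTrace K x) (rightTrace u x)
      - f (leftTrace K x) (leftTrace u x) := fun x hx => by
    rw [hμv, distribDeriv_singleton hvv (hJab hx), rightTrace_comp hf hKv huv hui (hJab hx),
      leftTrace_comp hf hKv huv hui (hJab hx)]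
  refine ⟨isBV_of_boundedVariationOn hvv, ?_, fun i => ?_, ?_, fun φ hφ => ?_⟩
  · rw [hdK]
    exact integrable_variation_withDensityᵥ hgK' hYm (hYi _ hgK')
  · rw [hdu i]
    exact integrable_variation_withDensityᵥ (hgu' i) (hWm i) (hWi i _ (hgu' i))
  · exact (hasSum_apply_singleton μv hJ).summable.congr fun x => hjump x x.2
  · have hφc := hφ.contDiff.continuous
    obtain ⟨C, hC⟩ := hφ.hasCompactSupport.exists_bound_of_continuous hφc
    have hφi : ∀ g, Integrable g σ → Integrable (fun x => φ x * g x) σ := fun g hg =>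
      hg.bdd_mul hφc.aestronglyMeasurable (Eventually.of_forall hC)
    have hφY : Integrable (fun x => φ x * partialY f (K x) (u x) * Jᶜ.indicator gK x) σ := by
      simpa only [mul_assoc] using hφi _ (hYi _ hgK')
    have hφW : ∀ i, Integrable
        (fun x => φ x * partialW f (K x) (u x) i * Jᶜ.indicator (gu i) x) σ := fun i => by
      simpa only [mul_assoc] using hφi _ (hWi i _ (hgu' i))
    have hcompl : ∫ x in Jᶜ, φ x * gv x ∂σ =
        ∫ᵛ x, φ x * partialY f (K x) (u x) ∂<•(diffusePart a b K) +
        ∑ i, ∫ᵛ x, φ x * partialW f (K x) (u x) i ∂<•(diffusePart a b (fun x => u x i)) := by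
      simp only [hdu]
      rw [hdK, integral_withDensityᵥ (φ := fun x => φ x * partialY f (K x) (u x)) hgK'
        (hφc.aestronglyMeasurable.mul hYm) hφY]
      simp only [fun i => integral_withDensityᵥ (φ := fun x => φ x * partialW f (K x) (u x) i)
        (hgu' i) (hφc.aestronglyMeasurable.mul (hWm i)) (hφW i)]
      rw [← integral_finsetSum _ fun i _ => hφW i,
        ← integral_add hφY (integrable_finsetSum _ fun i _ => hφW i),
        ← integral_indicator hJm.compl]
      refine integral_congr_ae ?_
      filter_upwards [hdens] with x hx
      by_cases hxJ : x ∈ J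
      · simp [hxJ]
      · simp [hxJ, hx hxJ, mul_add, Finset.mul_sum, mul_assoc]
    have hsum : ∫ x in J, φ x * gv x ∂σ = ∑' x : J, φ x *
        (f (rightTrace K x) (rightTrace u x) - f (leftTrace K x) (leftTrace u x)) := by
      rw [setIntegral_countable _ hJ (hφi _ hgv).integrableOn]
      refine tsum_congr fun x => ?_
      rw [← hjump x x.2, hμgv, withDensityᵥ_apply hgv (measurableSet_singleton _),
        integral_singleton, smul_eq_mul, smul_eq_mul]
      ring
    have hmain : ∫ x in Ioo a b, deriv φ x * f (K x) (u x) = -∫ x, φ x * gv x ∂σ := by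
      rw [← integral_withDensityᵥ hgv hφc.aestronglyMeasurable (hφi _ hgv), ← hμgv,
        ← (isDistribDeriv_distribDeriv hvv).2 φ hφ]
      simp only [mul_comm]
    rw [hmain, ← integral_add_compl hJm (hφi _ hgv), hcompl, hsum]
    ring
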